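/- Let $\mathcal C$ be a triangulated category and let $\mathcal D=(\mathcal D^{\le 0},\mathcal D^{\ge 0})$, $\mathcal T=(\mathcal T^{\le 0},\mathcal T^{\ge 0})$ be non-degenerate $t$-structures on $\mathcal C$ with hearts $\mathcal H_{\mathcal D},\mathcal H_{\mathcal T}$; write $\tau^{\ge i}$ for the truncation functors and $H^i_{\mathcal T}$ for the cohomology functors of $\mathcal T$. Assume that * $(\mathcal D,\mathcal T)$ is right filterable: for every $i\in\mathbb Z$ the class $\mathcal D^{\ge i}\cap\mathcal T^{\ge 0}$ is the co-aisle of some $t$-structure; * $(\mathcal D,\mathcal T)$ is of type $(n,0)$, $n\in\mathbb N$: $0$ is the largest integer $k$ with $\mathcal T^{\le k}\subseteq\mathcal D^{\le 0}$, and $n$ is the least natural number with $\mathcal D^{\le -n}\subseteq\mathcal T^{\le 0}$. Let $\mathcal D_i$ be the $t$-structure with co-aisle $\mathcal D^{\ge -i}\cap\mathcal T^{\ge 0}$, let $\mathcal H_i$ be its heart, and put $\mathcal X_i=\mathcal D_{i+1}^{\le 0}\cap\mathcal H_i$, $\mathcal Y_i=\mathcal D_{i+1}^{\ge 1}\cap\mathcal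 H_i$. A right $t$-tree of $X\in\mathcal H_{\mathcal D}$ consists of objects (vertices) $X_{i_1\dots i_\ell}$, $0\le\ell\le n$, $i_1,\dots,i_\ell\in\{0,1\}$, with root $X_\emptyset=X$, and, for each $\ell<n$ and each $i_1\dots i_\ell$, of a short exact sequence $$0\to X_{i_1\dots i_\ell 0}\to X_{i_1\dots i_\ell}\to X_{i_1\dots i_\ell 1}\to 0$$ in $\mathcal H_\ell[-s]$, $s=i_1+\dots+i_\ell$, with $X_{i_1\dots i_\ell 0}\in\mathcal X_\ell[-s]$ and $X_{i_1\dots i_\ell 1}\in\mathcal Y_\ell[-s]$. The leaves are the vertices $X_{i_1\dots i_n}$; the leading leaf of degree $d$ is $X_{1\dots1\,0\dots0}$ ($d$ ones, $n-d$ zeros). A branch consists of the $n+1$ vertices on the path from the root to a leaf, and is nonzero if all of them are nonzero. For a $t$-structure $\mathcal E$, an object is $\mathcal E$-static of degree $d\in\mathbb Z$ if it belongs to $\mathcal H_{\mathcal E}[-d]$, and $\mathcal E$-static if this holds for some $d$. Equalities of objects below mean isomorphisms. Let $0\ne X\in\mathcal H_{\mathcal D}$. (1) $X$ has a right $t$-tree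 all of whose nonzero leaves are leading leaves lying in $\mathcal H_{\mathcal D}$ if and only if $H^i_{\mathcal T}X$ is $\mathcal D$-static of degree $-i$ for each $0\le i\le n$. In this case every right $t$-tree of $X$ has this property, all its vertices lie in $\mathcal H_{\mathcal D}$, and for each $0\le i\le n$: * $X_{\underbrace{1\dots1}_i}=\tau^{\ge i}X$ (as objects under $X$, with respect to the composite $X\to X_1\to\dots\to X_{1\dots 1}$ of the maps of the tree); * the leading leaf of degree $i$ is $H^i_{\mathcal T}X[-i]$, and $X_{\underbrace{1\dots1}_i0}=X_{\underbrace{1\dots1}_i00}=\dots=X_{\underbrace{1\dots1}_i\underbrace{0\dots0}_{n-i}}=H^i_{\mathcal T}X[-i]$ if $i<n$, where the maps of the tree between consecutive vertices of this chain are isomorphisms; * $X_{\underbrace{1\dots1}_i0j_{i+2}\dots j_\ell}=0$ whenever $i+2\le\ell\le n$ and $j_{i+2}\dots j_\ell\ne 0\dots0$. (2) $X$ has a right $t$-tree with a unique nonzero branch if and only if $X$ is $\mathcal T$-static. If $X$ is $\mathcal T$-static of degree $d$, then $0\le d\le n$, every right $t$-tree of $X$ has a unique nonzero branch, and its unique nonzero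 leaf is the leading leaf of degree $d$. -/

import Mathlib

open CategoryTheory CategoryTheory.Limits CategoryTheory.Pretriangulated CategoryTheory.Triangulated

universe v u

namespace TTree

noncomputable section

variable {C : Type u} [Category.{v} C] [Preadditive C] [HasZeroObject C] [HasShift C ℤ]
  [∀ n : ℤ, (shiftFunctor C n).Additive] [Pretriangulated C]

/-- A t-structure is non-degenerate if `⋂ t^{≤ m} = 0` and `⋂ t^{≥ m} = 0`. -/
def NonDegenerate (t : TStructure C) : Prop :=
  (∀ X : C, (∀ m : ℤ, t.le m X) → IsZero X) ∧ (∀ X : C, (∀ m : ℤ, t.ge m X) → IsZero X)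

/-- The t-cohomology functor `H^i(X) = t^{≥ 0} t^{≤ 0} (X[i])`, with values in `C`. -/
def cohomology (t : TStructure C) (i : ℤ) : C ⥤ C :=
  shiftFunctor C i ⋙ t.truncLE 0 ⋙ t.truncGE 0

/-- `X` is `t`-static of degree `d` if it belongs to `H_t[-d]`, i.e. if `X[d]` lies in the
heart `H_t`. (In Mathlib, `P.shift d` holds for `X` iff `P` holds for `X⟦d⟧`, so `P.shift d` is
the full subcategory `P[-d]`.) -/
def StaticOfDegree (t : TStructure C) (d : ℤ) (X : C) : Prop :=
  t.heart.shift d X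

/-- `X` is `t`-static if it is `t`-static of some degree. -/
def Static (t : TStructure C) (X : C) : Prop :=
  ∃ d : ℤ, StaticOfDegree t d X

/-- The pair `(D, T)` is of type `(n, k)`, i.e. it has gap `n` and shift `k`: `k` is the maximal
integer with `T^{≤ k} ⊆ D^{≤ 0}` and `n` is the minimal natural number with
`D^{≤ -n} ⊆ T^{≤ k}`. -/
def OfType (D T : TStructure C) (n : ℕ) (k : ℤ) : Prop :=
  IsGreatest {m : ℤ | T.le m ≤ D.le 0} k ∧ IsLeast {m : ℕ | D.le (-(m : ℤ)) ≤ T.le k} n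

/-- A full subcategory is a co-aisle if it is `t^{≥ 0}` for some t-structure `t`. -/
def IsCoaisle (P : ObjectProperty C) : Prop :=
  ∃ t : TStructure C, t.ge 0 = P

/-- The pair `(D, T)` is right filterable if every `D^{≥ i} ∩ T^{≥ 0}` is a co-aisle. -/
def RightFilterable (D T : TStructure C) : Prop :=
  ∀ i : ℤ, IsCoaisle (D.ge i ⊓ T.ge 0)

/-- A t-structure is determined by its co-aisle. -/
lemma ge_eq_of_ge_zero_eq {t t' : TStructure C} (e : t.ge 0 = t'.ge 0) (m : ℤ) :
    t.ge m = t'.ge m := by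
  ext X
  have key : ∀ s : TStructure C, s.ge m X ↔ s.ge 0 (X⟦m⟧) := fun s => by
    simpa using (s.isGE_shift_iff X m m 0 (by simp)).symm
  rw [key t, key t', e]

lemma le_eq_of_ge_zero_eq {t t' : TStructure C} (e : t.ge 0 = t'.ge 0) (m : ℤ) :
    t.le m = t'.le m := by
  ext X
  simp only [TStructure.le_iff_isLE, TStructure.isLE_iff_orthogonal _ m (m + 1) rfl,
    ← TStructure.ge_iff_isGE, ge_eq_of_ge_zero_eq e]

section Basic

variable {D T : TStructure C} (h : RightFilterable D T)

/-- The right basic t-structure `D_i`: the t-structure with co-aisle `D^{≥ -i} ∩ T^{≥ 0}`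
(a t-structure is determined by its co-aisle). -/
def basic (i : ℤ) : TStructure C := (h (-i)).choose

lemma basic_ge_zero (i : ℤ) : (basic h i).ge 0 = D.ge (-i) ⊓ T.ge 0 := (h (-i)).choose_spec

/-- The right basic torsion class `X_i = D_{i+1}^{≤ 0} ∩ H_i`. -/
def torsion (i : ℤ) : ObjectProperty C := (basic h (i + 1)).le 0 ⊓ (basic h i).heart

/-- The right basic torsion-free class `Y_i = D_{i+1}^{≥ 1} ∩ H_i`. -/
def torsionFree (i : ℤ) : ObjectProperty C := (basic h (i + 1)).ge 1 ⊓ (basic h i).heart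

end Basic

/-- `0 ⟶ A ⟶ B ⟶ E ⟶ 0` is a short exact sequence in the full subcategory `P`. -/
def ShortExactIn (P : ObjectProperty C) {A B E : C} (f : A ⟶ B) (g : B ⟶ E) : Prop :=
  ∃ (hA : P A) (hB : P B) (hE : P E) (w : f ≫ g = 0),
    (ShortComplex.mk (C := P.FullSubcategory) (X₁ := ⟨A, hA⟩) (X₂ := ⟨B, hB⟩) (X₃ := ⟨E, hE⟩)
      (ObjectProperty.homMk f) (ObjectProperty.homMk g)
      (by ext; exact w)).ShortExact

/-- The degree `i₁ + ⋯ + i_ℓ` of the word `i₁ ⋯ i_ℓ`. -/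
def degree (w : List (Fin 2)) : ℕ := (w.map Fin.val).sum

/-- The word `1 ⋯ 1` with `i` ones. -/
def ones : ℕ → List (Fin 2)
  | 0 => []
  | i + 1 => ones i ++ [1]

/-- The word `1 ⋯ 1 0 ⋯ 0` with `i` ones and `j` zeros. -/
def onesZeros (i : ℕ) : ℕ → List (Fin 2)
  | 0 => ones i
  | j + 1 => onesZeros i j ++ [0]

lemma ones_eq (i : ℕ) : ones i = List.replicate i 1 := by
  induction i with
  | zero => rfl
  | succ i ih => rw [ones, ih, List.replicate_succ']

lemma onesZeros_eq (i j : ℕ) :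
    onesZeros i j = List.replicate i 1 ++ List.replicate j 0 := by
  induction j with
  | zero => simp [onesZeros, ones_eq]
  | succ j ih => rw [onesZeros, ih, List.replicate_succ', List.append_assoc]

/-- A right t-tree of height `n` of the object `X` for the right filterable pair `(D, T)`.
The vertex `X_{i₁ ⋯ i_ℓ}` is `vertex [i₁, …, i_ℓ]`; only the words of length at most `n` are part
of the tree (values and arrows at longer words are unconstrained and never used). -/
structure RightTTree {D T : TStructure C} (h : RightFilterable D T) (n : ℕ) (X : C) where
  vertex : List (Fin 2) → C
  /-- the root of the tree is `X` -/
  root : vertex [] ≅ X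
  incl (w : List (Fin 2)) : vertex (w ++ [0]) ⟶ vertex w
  proj (w : List (Fin 2)) : vertex w ⟶ vertex (w ++ [1])
  /-- exactness of `0 ⟶ X_{w0} ⟶ X_w ⟶ X_{w1} ⟶ 0` in `H_ℓ[-(i₁ + ⋯ + i_ℓ)]` -/
  shortExact (w : List (Fin 2)) (hw : w.length < n) :
    ShortExactIn ((basic h w.length).heart.shift (degree w : ℤ)) (incl w) (proj w)
  torsion_mem (w : List (Fin 2)) (hw : w.length < n) :
    (torsion h w.length).shift (degree w : ℤ) (vertex (w ++ [0]))
  torsionFree_mem (w : List (Fin 2)) (hw : w.length < n) :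
    (torsionFree h w.length).shift (degree w : ℤ) (vertex (w ++ [1]))

namespace RightTTree

variable {D T : TStructure C} {h : RightFilterable D T} {n : ℕ} {X : C} (S : RightTTree h n X)

/-- The leaves are the vertices `X_w` with `w` of length `n`; the leading leaf of degree `d`
is the one with `w = 1 ⋯ 1 0 ⋯ 0` (`d` ones and `n - d` zeros). The condition says that every
nonzero leaf is a leading leaf and lies in `H_D`. -/
def NonzeroLeavesAreLeadingInHeart : Prop :=
  ∀ w : List (Fin 2), w.length = n → ¬ IsZero (S.vertex w) →
    (∃ d : ℕ, d ≤ n ∧ w = onesZeros d (n - d)) ∧ D.heart (S.vertex w)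

/-- The branch from the root to the leaf `X_w` is nonzero: all its `n + 1` vertices are. -/
def IsNonzeroBranch (w : List (Fin 2)) : Prop :=
  w.length = n ∧ ∀ l : ℕ, l ≤ n → ¬ IsZero (S.vertex (w.take l))

/-- The tree has a unique nonzero branch. -/
def HasUniqueNonzeroBranch : Prop := ∃! w : List (Fin 2), S.IsNonzeroBranch w

/-- The composite `X_∅ ⟶ X_1 ⟶ X_{11} ⟶ ⋯ ⟶ X_{1 ⋯ 1}` along the rightmost branch. -/
def toOnes : ∀ i : ℕ, S.vertex [] ⟶ S.vertex (ones i)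
  | 0 => 𝟙 _
  | i + 1 => toOnes i ≫ S.proj (ones i)

end RightTTree

end

end TTree

namespace TTree

variable {C : Type u} [Category.{v} C] [Preadditive C] [HasZeroObject C] [HasShift C ℤ]
  [∀ n : ℤ, (shiftFunctor C n).Additive] [Pretriangulated C]

/-! The t-structures `D_0 = D`, ..., `D_n = T` interpolate between `D` and `T`, and the short exact
sequence at a vertex `X_w` of length `ℓ` and degree `s` is a distinguished triangle
(`shortExactIn_heart_shift_iff`) which is exactly the `D_{ℓ+1}`-truncation triangle of `X_w` at `s`.
Hence trees exist by iterated truncation (`truncTree`), they are governed by uniqueness of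
truncation triangles, and a leaf of degree `s` lies in `H_T[-s]`.

Both directions of (1) compare the triangles `X_{1..10} ⟶ X_{1..1} ⟶ X_{1..11}` of the rightmost
branch with `τ^{≤ i} τ^{≥ i} X ⟶ τ^{≥ i} X ⟶ τ^{≥ i+1} X`, where the first term is `H^i_T(X)[-i]`.
If these first terms lie in `H_D`, so do all `τ^{≥ i} X`; then the second triangle is also a
`D_{i+1}`-truncation, and the two agree (`ones_step`). If instead only leading leaves survive,
`X_{1..10}` is the leading leaf of degree `i` and the tree's triangle is a `T`-truncation, so again
the two agree (`ones_step_of_leading`).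

For (2), zero vertices have only zero descendants and nonzero ones have a nonzero leaf below, so a
unique nonzero branch is a unique nonzero leaf; its siblings along the path vanish, so this leaf is
isomorphic to `X`. Conversely, the only nonzero `T`-cohomology of a `T`-static `X` is `X` up to
shift, so (1) applies. -/

/-- Distinguished triangles may be transported along isomorphisms of the three objects. -/
lemma exists_distTriang_of_iso {A B E A' B' E' : C} {f : A ⟶ B} {g : B ⟶ E}
    {δ : E ⟶ A⟦(1 : ℤ)⟧} (hT : Triangle.mk f g δ ∈ distTriang C) {f' : A' ⟶ B'} {g' : B' ⟶ E'}
    (a : A ≅ A') (b : B ≅ B') (c : E ≅ E') (h₁ : f ≫ b.hom = a.hom ≫ f')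
    (h₂ : g ≫ c.hom = b.hom ≫ g') :
    ∃ δ' : E' ⟶ A'⟦(1 : ℤ)⟧, Triangle.mk f' g' δ' ∈ distTriang C := by
  refine ⟨c.inv ≫ δ ≫ a.hom⟦(1 : ℤ)⟧', isomorphic_distinguished _ hT _
    (Triangle.isoMk (Triangle.mk f g δ) (Triangle.mk f' g' _) a b c h₁ h₂ ?_).symm⟩
  change δ ≫ a.hom⟦(1 : ℤ)⟧' = c.hom ≫ c.inv ≫ δ ≫ a.hom⟦(1 : ℤ)⟧'
  rw [Iso.hom_inv_id_assoc]

/-! ### Uniqueness of truncation triangles -/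

section Truncation

variable (t : TStructure C)

lemma heart_shift_iff (s : ℤ) (X : C) : t.heart.shift s X ↔ t.IsLE X s ∧ t.IsGE X s := by
  rw [ObjectProperty.prop_shift_iff, t.mem_heart_iff, t.isLE_shift_iff X s s 0,
    t.isGE_shift_iff X s s 0]

/-- Truncation triangles are unique: an isomorphism between the middle objects extends to the
outer objects. -/
lemma exists_iso_of_truncation_triangles {A B E A' B' E' : C} {f : A ⟶ B} {g : B ⟶ E}
    {δ : E ⟶ A⟦(1 : ℤ)⟧} {f' : A' ⟶ B'} {g' : B' ⟶ E'} {δ' : E' ⟶ A'⟦(1 : ℤ)⟧}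
    (hT : Triangle.mk f g δ ∈ distTriang C) (hT' : Triangle.mk f' g' δ' ∈ distTriang C)
    (e : B ≅ B') (s : ℤ) (hA : t.IsLE A s) (hE : t.IsGE E (s + 1)) (hA' : t.IsLE A' s)
    (hE' : t.IsGE E' (s + 1)) :
    ∃ (a : A ≅ A') (c : E ≅ E'), f ≫ e.hom = a.hom ≫ f' ∧ g ≫ c.hom = e.hom ≫ g' := by
  obtain ⟨e', he'⟩ := t.triangle_iso_exists hT hT' e s (s + 1) hA hE hA' hE'
  have h₁ := e'.hom.comm₁
  have h₂ := e'.hom.comm₂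
  rw [he'] at h₁ h₂
  exact ⟨Triangle.π₁.mapIso e', Triangle.π₃.mapIso e', h₁, h₂⟩

/-- If the middle object of a truncation triangle lies in the aisle, then the triangle is
trivial. -/
lemma isIso_mor₁_of_isLE {A B E : C} {f : A ⟶ B} {g : B ⟶ E} {δ : E ⟶ A⟦(1 : ℤ)⟧}
    (hT : Triangle.mk f g δ ∈ distTriang C) (s : ℤ) (hA : t.IsLE A s) (hE : t.IsGE E (s + 1))
    (hB : t.IsLE B s) : IsIso f ∧ IsZero E := by
  obtain ⟨a, c, h₁, -⟩ := exists_iso_of_truncation_triangles t hT (contractible_distinguished B)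
    (Iso.refl B) s hA hE hB (t.isGE_of_isZero (isZero_zero C) _)
  have : f = a.hom := by simpa using h₁
  exact ⟨this ▸ inferInstance, (isZero_zero C).of_iso c⟩

/-- If the middle object of a truncation triangle lies in the co-aisle, then the triangle is
trivial. -/
lemma isIso_mor₂_of_isGE {A B E : C} {f : A ⟶ B} {g : B ⟶ E} {δ : E ⟶ A⟦(1 : ℤ)⟧}
    (hT : Triangle.mk f g δ ∈ distTriang C) (s : ℤ) (hA : t.IsLE A s) (hE : t.IsGE E (s + 1))
    (hB : t.IsGE B (s + 1)) : IsIso g ∧ IsZero A := by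
  obtain ⟨a, c, -, h₂⟩ := exists_iso_of_truncation_triangles t hT (contractible_distinguished₁ B)
    (Iso.refl B) s hA hE (t.isLE_of_isZero (isZero_zero C) _) hB
  have : g ≫ c.hom = 𝟙 B := by simpa using h₂
  refine ⟨?_, (isZero_zero C).of_iso a⟩
  rw [(IsIso.eq_comp_inv c.hom).2 this]
  infer_instance

lemma isLE₃_of_distTriang {A B E : C} {f : A ⟶ B} {g : B ⟶ E} {δ : E ⟶ A⟦(1 : ℤ)⟧}
    (hT : Triangle.mk f g δ ∈ distTriang C) (s : ℤ) (hA : t.IsLE A (s + 1)) (hB : t.IsLE B s) :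
    t.IsLE E s :=
  t.isLE₂ _ (rot_of_distTriang _ hT) s hB (t.isLE_shift A (s + 1) 1 s)

lemma isGE₁_of_distTriang {A B E : C} {f : A ⟶ B} {g : B ⟶ E} {δ : E ⟶ A⟦(1 : ℤ)⟧}
    (hT : Triangle.mk f g δ ∈ distTriang C) (s : ℤ) (hB : t.IsGE B s) (hE : t.IsGE E (s - 1)) :
    t.IsGE A s :=
  t.isGE₂ _ (inv_rot_of_distTriang _ hT) s (t.isGE_shift E (s - 1) (-1) s) hB

/-- The truncation triangle `X^{≤ s} ⟶ X ⟶ X^{≥ s + 1}`. -/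
lemma exists_truncation_triangle (X : C) (s : ℤ) :
    ∃ δ : (t.truncGE (s + 1)).obj X ⟶ ((t.truncLE s).obj X)⟦(1 : ℤ)⟧,
      Triangle.mk ((t.truncLEι s).app X) ((t.truncGEπ (s + 1)).app X) δ ∈ distTriang C :=
  ⟨_, t.triangleLEGE_distinguished s (s + 1) rfl X⟩

end Truncation

/-! ### Short exact sequences in shifted hearts -/

section Heart

variable (t : TStructure C) (s : ℤ)

instance : (t.heart.shift s).ContainsZero where
  exists_zero := ⟨_, isZero_zero C, (heart_shift_iff t s _).2
    ⟨t.isLE_of_isZero (isZero_zero C) s, t.isGE_of_isZero (isZero_zero C) s⟩⟩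

instance : (t.heart.shift s).IsClosedUnderFiniteProducts :=
  have : (t.heart.shift s).IsClosedUnderBinaryProducts := by
    refine ⟨fun X ⟨p⟩ => ?_⟩
    have h₁ := (heart_shift_iff t s _).1 (p.prop_diag_obj (.mk .left))
    have h₂ := (heart_shift_iff t s _).1 (p.prop_diag_obj (.mk .right))
    have hT := binaryProductTriangle_distinguished (p.diag.obj (.mk .left))
      (p.diag.obj (.mk .right))
    refine (t.heart.shift s).prop_of_iso ?_ ((heart_shift_iff t s _).2
      ⟨t.isLE₂ _ hT s h₁.1 h₂.1, t.isGE₂ _ hT s h₁.2 h₂.2⟩)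
    exact IsLimit.conePointUniqueUpToIso (prodIsProd _ _)
      ((IsLimit.postcomposeHomEquiv (diagramIsoPair p.diag) _).2 p.isLimit)
  .mk'

lemma heart_shift_hom_eq_zero ⦃X Y : (t.heart.shift s).FullSubcategory⦄ ⦃n : ℤ⦄
    (f : (t.heart.shift s).ι.obj X ⟶ ((t.heart.shift s).ι.obj Y)⟦n⟧) (hn : n < 0) : f = 0 := by
  obtain ⟨X, hX⟩ := X
  obtain ⟨Y, hY⟩ := Y
  obtain ⟨hX, -⟩ := (heart_shift_iff t s X).1 hX
  obtain ⟨-, hY⟩ := (heart_shift_iff t s Y).1 hY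
  exact t.zero_of_isLE_of_isGE (X := X) f s (s - n) (by lia) hX (t.isGE_shift Y s n (s - n))

/-- The cone of a map in `H[-s]` is concentrated in degrees `s - 1` and `s`; its two pieces are the
shifted kernel and the cokernel. -/
lemma heart_shift_admissible :
    AbelianSubcategory.admissibleMorphism (t.heart.shift s).ι = ⊤ := by
  ext X₁ X₂ f₁
  simp only [MorphismProperty.top_apply, iff_true]
  intro X₃ f₂ f₃ hT
  obtain ⟨X₁, h₁⟩ := X₁
  obtain ⟨X₂, h₂⟩ := X₂
  obtain ⟨l₁, g₁⟩ := (heart_shift_iff t s X₁).1 h₁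
  obtain ⟨l₂, g₂⟩ := (heart_shift_iff t s X₂).1 h₂
  have l₃ : t.IsLE X₃ s := isLE₃_of_distTriang t hT s (t.isLE_of_le X₁ s (s + 1)) l₂
  have g₃ : t.IsGE X₃ (s - 1) := t.isGE₂ _ (rot_of_distTriang _ hT) (s - 1)
    (t.isGE_of_ge X₂ (s - 1) s) (t.isGE_shift X₁ s 1 (s - 1))
  obtain ⟨L, R, hL, hR, f, g, δ, h⟩ := t.exists_triangle X₃ (s - 1) s (by lia)
  rw [t.le_iff_isLE] at hL
  rw [t.ge_iff_isGE] at hR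
  have hL' : t.IsGE L (s - 1) :=
    isGE₁_of_distTriang t h (s - 1) g₃ (t.isGE_of_ge R (s - 1 - 1) s)
  have hR' : t.IsLE R s :=
    isLE₃_of_distTriang t h s (t.isLE_of_le L (s - 1) (s + 1)) l₃
  -- `L` sits in degree `s - 1`, so the object of `H[-s]` playing the role of the kernel is `L⟦-1⟧`.
  let e : (L⟦(-1 : ℤ)⟧)⟦(1 : ℤ)⟧ ≅ L := (shiftEquiv C (1 : ℤ)).counitIso.app L
  obtain ⟨δ', h'⟩ := exists_distTriang_of_iso h (f' := e.hom ≫ f) (g' := g) e.symm (Iso.refl _)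
    (Iso.refl _) (by simp) (by simp)
  exact ⟨⟨L⟦(-1 : ℤ)⟧, (heart_shift_iff t s _).2
    ⟨t.isLE_shift L (s - 1) (-1) s, t.isGE_shift L (s - 1) (-1) s⟩⟩,
    ⟨R, (heart_shift_iff t s _).2 ⟨hR', hR⟩⟩, e.hom ≫ f, g, δ', h'⟩

/-- An epimorphism of the heart extends to a triangle whose first term is its kernel, and kernels
are unique. Conversely, a triangle with vertices in the heart exhibits both a kernel and a cokernel.
-/
lemma shortExactIn_heart_shift_iff [IsTriangulated C] {A B E : C} (f : A ⟶ B) (g : B ⟶ E) :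
    ShortExactIn (t.heart.shift s) f g ↔
      t.heart.shift s A ∧ t.heart.shift s B ∧ t.heart.shift s E ∧
        ∃ δ : E ⟶ A⟦(1 : ℤ)⟧, Triangle.mk f g δ ∈ distTriang C := by
  let := AbelianSubcategory.abelian (t.heart.shift s).ι (heart_shift_hom_eq_zero t s)
    (heart_shift_admissible t s)
  refine ⟨fun ⟨hA, hB, hE, w, h⟩ => ⟨hA, hB, hE, ?_⟩, fun ⟨hA, hB, hE, δ, h⟩ =>
    ⟨hA, hB, hE, comp_distTriang_mor_zero₁₂ _ h, ?_⟩⟩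
  · have := h.epi_g
    obtain ⟨K, i, δ, hT⟩ := AbelianSubcategory.exists_distinguished_triangle_of_epi
      (heart_shift_hom_eq_zero t s) (heart_shift_admissible t s)
      ((t.heart.shift s).homMk g : (⟨B, hB⟩ : (t.heart.shift s).FullSubcategory) ⟶ ⟨E, hE⟩)
    have hK := AbelianSubcategory.isLimitKernelForkOfDistTriang
      (heart_shift_hom_eq_zero t s) _ _ _ hT
    let e := IsLimit.conePointUniqueUpToIso h.fIsKernel hK
    have he : e.hom ≫ i = (t.heart.shift s).homMk f :=
      IsLimit.conePointUniqueUpToIso_hom_comp h.fIsKernel hK .zero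
    let e' : A ≅ K.obj := (t.heart.shift s).ι.mapIso e
    have he' : e'.hom ≫ i.hom = f := congr_arg (fun φ => φ.hom) he
    exact exists_distTriang_of_iso hT e'.symm (Iso.refl _) (Iso.refl _)
      (by rw [← he']; exact (Category.comp_id _).trans (e'.inv_hom_id_assoc _).symm)
      ((Category.comp_id _).trans (Category.id_comp _).symm)
  · have hK := AbelianSubcategory.isLimitKernelForkOfDistTriang (ι := (t.heart.shift s).ι)
      (X₁ := ⟨A, hA⟩) (X₂ := ⟨B, hB⟩) (X₃ := ⟨E, hE⟩)
      (heart_shift_hom_eq_zero t s) (ObjectProperty.homMk f) (ObjectProperty.homMk g) δ h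
    have hC := AbelianSubcategory.isColimitCokernelCoforkOfDistTriang (ι := (t.heart.shift s).ι)
      (X₁ := ⟨A, hA⟩) (X₂ := ⟨B, hB⟩) (X₃ := ⟨E, hE⟩)
      (heart_shift_hom_eq_zero t s) (ObjectProperty.homMk f) (ObjectProperty.homMk g) δ h
    exact { exact := ShortComplex.exact_of_f_is_kernel _ hK
            mono_f := mono_of_isLimit_fork hK
            epi_g := epi_of_isColimit_cofork hC }

end Heart

end TTree

namespace TTree

variable {C : Type u} [Category.{v} C] [Preadditive C] [HasZeroObject C] [HasShift C ℤ]
  [∀ n : ℤ, (shiftFunctor C n).Additive] [Pretriangulated C]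

/-! ### Comparison of `D`, `T` and the basic t-structures -/

/-- Aisles are left orthogonals of co-aisles, so an inclusion of co-aisles reverses. -/
lemma isLE_of_forall_isGE {t t' : TStructure C} {s s' : ℤ}
    (H : ∀ Y : C, t'.IsGE Y (s' + 1) → t.IsGE Y (s + 1)) {X : C} (hX : t.IsLE X s) :
    t'.IsLE X s' := by
  rw [t'.isLE_iff_orthogonal s' (s' + 1) rfl]
  intro Y f hY
  exact t.zero_of_isLE_of_isGE f s (s + 1) (by lia) hX (H Y hY)

lemma isGE_of_forall_isLE {t t' : TStructure C} {s s' : ℤ}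
    (H : ∀ Y : C, t'.IsLE Y (s' - 1) → t.IsLE Y (s - 1)) {X : C} (hX : t.IsGE X s) :
    t'.IsGE X s' := by
  rw [t'.isGE_iff_orthogonal (s' - 1) s' (by lia)]
  intro Y f hY
  exact t.zero_of_isLE_of_isGE f (s - 1) s (by lia) (H Y hY) hX

section OfType

variable {D T : TStructure C} {n : ℕ}

lemma OfType.isLE_of_isLE (hn : OfType D T n 0) {X : C} {s : ℤ} (hX : T.IsLE X s) :
    D.IsLE X s := by
  have := hn.1.1 (X⟦s⟧) (T.isLE_shift X s s 0).le
  rwa [D.le_iff_isLE, D.isLE_shift_iff X s s 0] at this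

lemma OfType.isLE_add_of_isLE (hn : OfType D T n 0) {X : C} {s : ℤ} (hX : D.IsLE X s) :
    T.IsLE X (s + n) := by
  have := hn.2.1 (X⟦s + n⟧) (D.isLE_shift X s (s + n) (-n)).le
  rwa [T.le_iff_isLE, T.isLE_shift_iff X (s + n) (s + n) 0] at this

lemma OfType.isGE_of_isGE (hn : OfType D T n 0) {X : C} {s : ℤ} (hX : D.IsGE X s) :
    T.IsGE X s :=
  isGE_of_forall_isLE (fun _ => hn.isLE_of_isLE) hX

lemma OfType.isGE_sub_of_isGE (hn : OfType D T n 0) {X : C} {s : ℤ} (hX : T.IsGE X s) :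
    D.IsGE X (s - n) :=
  isGE_of_forall_isLE (fun Y hY =>
    have := hn.isLE_add_of_isLE hY
    T.isLE_of_le Y (s - n - 1 + n) (s - 1)) hX

end OfType

section Basic

variable {D T : TStructure C} (h : RightFilterable D T)

/-- All properties of `D_i` below come from this description of its co-aisles; its aisles are
reached only by orthogonality. -/
lemma basic_isGE_iff (i s : ℤ) (X : C) :
    (basic h i).IsGE X s ↔ D.IsGE X (s - i) ∧ T.IsGE X s := by
  rw [← (basic h i).isGE_shift_iff X s s 0, ← TStructure.ge_iff_isGE, basic_ge_zero,
    ObjectProperty.prop_inf_iff, D.ge_iff_isGE, T.ge_iff_isGE, D.isGE_shift_iff X (s - i) s (-i),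
    T.isGE_shift_iff X s s 0]

lemma basic_isGE_succ {i s : ℤ} {X : C} (hX : (basic h i).IsGE X s) :
    (basic h (i + 1)).IsGE X s := by
  rw [basic_isGE_iff] at hX ⊢
  have := hX.1
  exact ⟨D.isGE_of_ge X _ (s - i), hX.2⟩

lemma basic_isLE_succ {i s : ℤ} {X : C} (hX : (basic h i).IsLE X s) :
    (basic h (i + 1)).IsLE X (s + 1) := by
  refine isLE_of_forall_isGE (fun Y hY => ?_) hX
  rw [basic_isGE_iff] at hY ⊢
  obtain ⟨h₁, h₂⟩ := hY
  exact ⟨D.isGE_of_ge Y _ (s + 1 + 1 - (i + 1)), T.isGE_of_ge Y _ (s + 1 + 1)⟩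

lemma basic_isLE_of_isLE (i : ℤ) {s : ℤ} {X : C} (hX : T.IsLE X s) : (basic h i).IsLE X s :=
  isLE_of_forall_isGE (fun Y hY => ((basic_isGE_iff h i _ Y).1 hY).2) hX

variable {n : ℕ} (hn : OfType D T n 0)

include hn

lemma basic_zero_isGE_iff (s : ℤ) (X : C) : (basic h 0).IsGE X s ↔ D.IsGE X s := by
  rw [basic_isGE_iff, sub_zero]
  exact ⟨fun hX => hX.1, fun hX => ⟨hX, hn.isGE_of_isGE hX⟩⟩

lemma basic_zero_isLE_iff (s : ℤ) (X : C) : (basic h 0).IsLE X s ↔ D.IsLE X s :=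
  ⟨isLE_of_forall_isGE fun Y => (basic_zero_isGE_iff h hn _ Y).2,
    isLE_of_forall_isGE fun Y => (basic_zero_isGE_iff h hn _ Y).1⟩

/-- The gap gives `T^{≥ s} ⊆ D^{≥ s - n}`, which makes the condition on `D` redundant: `D_n = T`. -/
lemma basic_gap_isGE_iff (s : ℤ) (X : C) : (basic h n).IsGE X s ↔ T.IsGE X s := by
  rw [basic_isGE_iff]
  exact ⟨fun hX => hX.2, fun hX => ⟨hn.isGE_sub_of_isGE hX, hX⟩⟩

lemma basic_gap_isLE_iff (s : ℤ) (X : C) : (basic h n).IsLE X s ↔ T.IsLE X s :=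
  ⟨isLE_of_forall_isGE fun Y => (basic_gap_isGE_iff h hn _ Y).2,
    isLE_of_forall_isGE fun Y => (basic_gap_isGE_iff h hn _ Y).1⟩

end Basic

/-! ### Cohomology as a double truncation -/

section Cohomology

lemma exists_distTriang_shift {A B E : C} {f : A ⟶ B} {g : B ⟶ E} {δ : E ⟶ A⟦(1 : ℤ)⟧}
    (hT : Triangle.mk f g δ ∈ distTriang C) (i : ℤ) :
    ∃ (f' : A⟦i⟧ ⟶ B⟦i⟧) (g' : B⟦i⟧ ⟶ E⟦i⟧) (δ' : E⟦i⟧ ⟶ A⟦i⟧⟦(1 : ℤ)⟧),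
      Triangle.mk f' g' δ' ∈ distTriang C :=
  ⟨_, _, _, Triangle.shift_distinguished _ hT i⟩

variable (t : TStructure C)

lemma nonempty_truncLE_shift_iso (X : C) (i : ℤ) :
    Nonempty ((t.truncLE 0).obj (X⟦i⟧) ≅ ((t.truncLE i).obj X)⟦i⟧) := by
  obtain ⟨δ, h⟩ := exists_truncation_triangle t X i
  obtain ⟨δ', h'⟩ := exists_truncation_triangle t (X⟦i⟧) 0
  obtain ⟨f, g, ε, h⟩ := exists_distTriang_shift h i
  obtain ⟨a, -⟩ := exists_iso_of_truncation_triangles t h' h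
    (Iso.refl _) 0 inferInstance inferInstance (t.isLE_shift _ i i 0) (t.isGE_shift _ (i + 1) i _)
  exact ⟨a⟩

lemma nonempty_truncGE_shift_iso (X : C) (i : ℤ) :
    Nonempty ((t.truncGE 0).obj (X⟦i⟧) ≅ ((t.truncGE i).obj X)⟦i⟧) := by
  obtain ⟨f, g, ε, h⟩ := exists_distTriang_shift (t.triangleLTGE_distinguished i X) i
  have h' := t.triangleLTGE_distinguished 0 (X⟦i⟧)
  obtain ⟨-, c, -⟩ := exists_iso_of_truncation_triangles t h' h
    (Iso.refl _) (-1) (t.isLE_truncLT_obj _ 0 (-1)) (t.isGE_truncGE_obj _ 0 (-1 + 1))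
    (t.isLE_shift _ (i - 1) i _)
    (t.isGE_shift _ i i _)
  exact ⟨c⟩

lemma nonempty_cohomology_shift_iso [IsTriangulated C] (X : C) (i : ℤ) :
    Nonempty (((cohomology t i).obj X)⟦-i⟧ ≅ (t.truncLE i).obj ((t.truncGE i).obj X)) := by
  obtain ⟨a⟩ := nonempty_truncLE_shift_iso t ((t.truncGE i).obj X) i
  obtain ⟨b⟩ := nonempty_truncGE_shift_iso t X i
  exact ⟨(shiftFunctor C (-i)).mapIso ((t.truncGELEIsoLEGE 0 0).app (X⟦i⟧) ≪≫
    (t.truncLE 0).mapIso b ≪≫ a) ≪≫ (shiftEquiv C i).unitIso.symm.app _⟩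

/-- The triangle `t^{≤ i} t^{≥ i} X ⟶ t^{≥ i} X ⟶ t^{≥ i + 1} X`. -/
lemma exists_truncGE_triangle [IsTriangulated C] (X : C) (i : ℤ) :
    ∃ (f : (t.truncLE i).obj ((t.truncGE i).obj X) ⟶ (t.truncGE i).obj X)
      (g : (t.truncGE i).obj X ⟶ (t.truncGE (i + 1)).obj X) (δ : _ ⟶ _⟦(1 : ℤ)⟧),
      Triangle.mk f g δ ∈ distTriang C ∧
        (t.truncGEπ i).app X ≫ g = (t.truncGEπ (i + 1)).app X := by
  obtain ⟨δ, h⟩ := exists_truncation_triangle t ((t.truncGE i).obj X) i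
  have := t.isIso_truncGE_map_truncGEπ_app (i + 1) i (by lia) X
  let e := asIso ((t.truncGE (i + 1)).map ((t.truncGEπ i).app X))
  obtain ⟨δ', h'⟩ := exists_distTriang_of_iso h (f' := (t.truncLEι i).app _)
    (g' := (t.truncGEπ (i + 1)).app _ ≫ e.inv) (Iso.refl _) (Iso.refl _) e.symm (by simp) (by simp)
  refine ⟨_, _, δ', h', ?_⟩
  have hnat := (t.truncGEπ (i + 1)).naturality ((t.truncGEπ i).app X)
  rw [← Category.assoc, Iso.comp_inv_eq]
  exact hnat

lemma nonempty_truncLE_truncGE_iso {X : C} {i : ℤ} (hX : t.heart.shift i X) :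
    Nonempty ((t.truncLE i).obj ((t.truncGE i).obj X) ≅ X) := by
  obtain ⟨h₁, h₂⟩ := (heart_shift_iff t i X).1 hX
  exact ⟨(t.truncLE i).mapIso (asIso ((t.truncGEπ i).app X)).symm ≪≫
    asIso ((t.truncLEι i).app X)⟩

lemma isZero_truncLE_truncGE [IsTriangulated C] {X : C} {i d : ℤ} (hX : t.heart.shift d X)
    (hid : i ≠ d) : IsZero ((t.truncLE i).obj ((t.truncGE i).obj X)) := by
  obtain ⟨h₁, h₂⟩ := (heart_shift_iff t d X).1 hX
  rcases lt_or_gt_of_ne hid with hlt | hlt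
  · have : t.IsGE ((t.truncLE i).obj ((t.truncGE i).obj X)) d := inferInstance
    exact t.isZero _ i d
  · have : t.IsLE ((t.truncLE i).obj ((t.truncGE i).obj X)) d := inferInstance
    have : t.IsGE ((t.truncLE i).obj ((t.truncGE i).obj X)) i := inferInstance
    exact t.isZero _ d i

end Cohomology

end TTree

namespace TTree

variable {C : Type u} [Category.{v} C] [Preadditive C] [HasZeroObject C] [HasShift C ℤ]
  [∀ n : ℤ, (shiftFunctor C n).Additive] [Pretriangulated C]

/-! ### The torsion pairs between consecutive hearts -/

section TorsionPair

variable {D T : TStructure C} (h : RightFilterable D T)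

lemma basic_isLE_of_succ {i s : ℤ} {X : C} (hX : (basic h (i + 1)).IsLE X s) :
    (basic h i).IsLE X s :=
  isLE_of_forall_isGE (fun _ hY => basic_isGE_succ h hY) hX

lemma basic_isGE_of_succ {i s : ℤ} {X : C} (hX : (basic h (i + 1)).IsGE X (s + 1)) :
    (basic h i).IsGE X s := by
  rw [basic_isGE_iff] at hX ⊢
  obtain ⟨h₁, h₂⟩ := hX
  exact ⟨D.isGE_of_ge X _ (s + 1 - (i + 1)), T.isGE_of_ge X _ (s + 1)⟩

lemma torsion_shift_iff (i s : ℤ) (X : C) :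
    (torsion h i).shift s X ↔ (basic h (i + 1)).IsLE X s ∧ (basic h i).heart.shift s X := by
  rw [← (basic h (i + 1)).isLE_shift_iff X s s 0, ← TStructure.le_iff_isLE]
  rfl

lemma torsionFree_shift_iff (i s : ℤ) (X : C) :
    (torsionFree h i).shift s X ↔
      (basic h (i + 1)).IsGE X (s + 1) ∧ (basic h i).heart.shift s X := by
  rw [← (basic h (i + 1)).isGE_shift_iff X (s + 1) s 1, ← TStructure.ge_iff_isGE]
  rfl

lemma heart_succ_of_torsion {i s : ℤ} {X : C} (hX : (torsion h i).shift s X) :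
    (basic h (i + 1)).heart.shift s X := by
  rw [torsion_shift_iff, heart_shift_iff] at hX
  exact (heart_shift_iff _ _ _).2 ⟨hX.1, basic_isGE_succ h hX.2.2⟩

lemma heart_succ_of_torsionFree {i s : ℤ} {X : C} (hX : (torsionFree h i).shift s X) :
    (basic h (i + 1)).heart.shift (s + 1) X := by
  rw [torsionFree_shift_iff, heart_shift_iff] at hX
  exact (heart_shift_iff _ _ _).2 ⟨basic_isLE_succ h hX.2.1, hX.1⟩

/-- The truncation triangle of `D_{i+1}` at an object of `H_i[-s]` is the decomposition with
respect to the torsion pair `(X_i[-s], Y_i[-s])`. -/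
lemma torsion_decomposition {i s : ℤ} {A B E : C} {f : A ⟶ B} {g : B ⟶ E} {δ : E ⟶ A⟦(1 : ℤ)⟧}
    (hT : Triangle.mk f g δ ∈ distTriang C) (hB : (basic h i).heart.shift s B)
    (hA : (basic h (i + 1)).IsLE A s) (hE : (basic h (i + 1)).IsGE E (s + 1)) :
    (torsion h i).shift s A ∧ (torsionFree h i).shift s E := by
  obtain ⟨h₁, h₂⟩ := (heart_shift_iff _ _ _).1 hB
  have hA' := basic_isLE_of_succ h hA
  have hE' := basic_isGE_of_succ h hE
  refine ⟨(torsion_shift_iff h i s A).2 ⟨hA, (heart_shift_iff _ _ _).2 ⟨hA', ?_⟩⟩,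
    (torsionFree_shift_iff h i s E).2 ⟨hE, (heart_shift_iff _ _ _).2 ⟨?_, hE'⟩⟩⟩
  · exact isGE₁_of_distTriang _ hT s h₂ ((basic h i).isGE_of_ge E (s - 1) s)
  · exact isLE₃_of_distTriang _ hT s ((basic h i).isLE_of_le A s (s + 1)) h₁

end TorsionPair

lemma degree_append_zero (w : List (Fin 2)) : degree (w ++ [0]) = degree w := by
  simp [degree]

lemma degree_append_one (w : List (Fin 2)) : degree (w ++ [1]) = degree w + 1 := by
  simp [degree]

/-! ### Existence of trees by iterated truncation -/

section Existence

variable {D T : TStructure C} (h : RightFilterable D T) (X : C)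

/-- The vertices of the tree of iterated truncations of `X`, indexed by reversed words. -/
noncomputable def truncVertexAux : List (Fin 2) → C
  | [] => X
  | a :: r =>
    if a = 0 then
      ((basic h (r.reverse.length + 1)).truncLE (degree r.reverse)).obj (truncVertexAux r)
    else ((basic h (r.reverse.length + 1)).truncGE (degree r.reverse + 1)).obj (truncVertexAux r)

/-- The vertices of the tree of iterated truncations of `X`. -/
noncomputable def truncVertex (w : List (Fin 2)) : C := truncVertexAux h X w.reverse

lemma truncVertex_append_zero (w : List (Fin 2)) :
    truncVertex h X (w ++ [0]) =
      ((basic h (w.length + 1)).truncLE (degree w)).obj (truncVertex h X w) := by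
  simp [truncVertex, truncVertexAux]

lemma truncVertex_append_one (w : List (Fin 2)) :
    truncVertex h X (w ++ [1]) =
      ((basic h (w.length + 1)).truncGE (degree w + 1)).obj (truncVertex h X w) := by
  simp [truncVertex, truncVertexAux]

/-- The map `X_{w0} ⟶ X_w` in the tree of iterated truncations. -/
noncomputable def truncVertexIncl (w : List (Fin 2)) :
    truncVertex h X (w ++ [0]) ⟶ truncVertex h X w :=
  eqToHom (truncVertex_append_zero h X w) ≫ ((basic h (w.length + 1)).truncLEι _).app _

/-- The map `X_w ⟶ X_{w1}` in the tree of iterated truncations. -/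
noncomputable def truncVertexProj (w : List (Fin 2)) :
    truncVertex h X w ⟶ truncVertex h X (w ++ [1]) :=
  ((basic h (w.length + 1)).truncGEπ _).app _ ≫ eqToHom (truncVertex_append_one h X w).symm

lemma exists_truncVertex_triangle (w : List (Fin 2)) :
    ∃ δ, Triangle.mk (truncVertexIncl h X w) (truncVertexProj h X w) δ ∈ distTriang C := by
  obtain ⟨δ, hT⟩ := exists_truncation_triangle (basic h (w.length + 1)) (truncVertex h X w)
    (degree w)
  exact exists_distTriang_of_iso hT (eqToIso (truncVertex_append_zero h X w).symm) (Iso.refl _)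
    (eqToIso (truncVertex_append_one h X w).symm) (by simp [truncVertexIncl])
    (by rw [Iso.refl_hom, Category.id_comp]; rfl)

variable {X}

lemma truncVertex_torsion {w : List (Fin 2)}
    (hw : (basic h w.length).heart.shift (degree w : ℤ) (truncVertex h X w)) :
    (torsion h w.length).shift (degree w : ℤ) (truncVertex h X (w ++ [0])) ∧
      (torsionFree h w.length).shift (degree w : ℤ) (truncVertex h X (w ++ [1])) := by
  obtain ⟨δ, hT⟩ := exists_truncVertex_triangle h X w
  refine torsion_decomposition h hT hw ?_ ?_
  · rw [truncVertex_append_zero]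
    infer_instance
  · rw [truncVertex_append_one]
    infer_instance

/-- Passing from `H_i` to `H_{i+1}`, torsion objects keep their degree while torsion-free ones gain
one. A bare family `V` is used so that the argument serves both the construction of `truncTree` and
arbitrary trees. -/
lemma heart_of_torsion_tree {V : List (Fin 2) → C} {n : ℕ}
    (h₀ : (basic h 0).heart.shift (0 : ℤ) (V []))
    (H : ∀ w : List (Fin 2), w.length < n →
      (basic h w.length).heart.shift (degree w : ℤ) (V w) →
      (torsion h w.length).shift (degree w : ℤ) (V (w ++ [0])) ∧
        (torsionFree h w.length).shift (degree w : ℤ) (V (w ++ [1])))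
    (w : List (Fin 2)) (hw : w.length ≤ n) :
    (basic h w.length).heart.shift (degree w : ℤ) (V w) := by
  induction w using List.reverseRecOn with
  | nil => exact h₀
  | append_singleton w a ih =>
    rw [List.length_append, List.length_singleton] at hw
    have := H w (by lia) (ih (by lia))
    rw [List.length_append, List.length_singleton, Nat.cast_add, Nat.cast_one]
    match a with
    | 0 =>
      rw [degree_append_zero]
      exact heart_succ_of_torsion h this.1
    | 1 =>
      rw [degree_append_one, Nat.cast_add, Nat.cast_one]
      exact heart_succ_of_torsionFree h this.2

/-- The tree of iterated truncations. -/
noncomputable def truncTree [IsTriangulated C] (hX : (basic h 0).heart.shift (0 : ℤ) X) (n : ℕ) :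
    RightTTree h n X :=
  have mem (w : List (Fin 2)) :
      (basic h w.length).heart.shift (degree w : ℤ) (truncVertex h X w) :=
    heart_of_torsion_tree h (n := w.length) hX (fun _ _ => truncVertex_torsion h) w le_rfl
  { vertex := truncVertex h X
    root := Iso.refl _
    incl := truncVertexIncl h X
    proj := truncVertexProj h X
    shortExact := fun w _ => (shortExactIn_heart_shift_iff _ _ _ _).2
      ⟨((torsion_shift_iff h _ _ _).1 (truncVertex_torsion h (mem w)).1).2, mem w,
        ((torsionFree_shift_iff h _ _ _).1 (truncVertex_torsion h (mem w)).2).2,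
        exists_truncVertex_triangle h X w⟩
    torsion_mem := fun w _ => (truncVertex_torsion h (mem w)).1
    torsionFree_mem := fun w _ => (truncVertex_torsion h (mem w)).2 }

end Existence

/-! ### Vanishing and nonvanishing in an arbitrary tree -/

namespace RightTTree

variable {D T : TStructure C} {h : RightFilterable D T} {n : ℕ} {X : C}
  (S : RightTTree h n X)

lemma isLE_append_zero {w : List (Fin 2)} (hw : w.length < n) :
    (basic h (w.length + 1)).IsLE (S.vertex (w ++ [0])) (degree w) :=
  ((torsion_shift_iff h _ _ _).1 (S.torsion_mem w hw)).1

lemma isGE_append_one {w : List (Fin 2)} (hw : w.length < n) :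
    (basic h (w.length + 1)).IsGE (S.vertex (w ++ [1])) (degree w + 1) :=
  ((torsionFree_shift_iff h _ _ _).1 (S.torsionFree_mem w hw)).1

lemma heart_vertex (hn : OfType D T n 0) (hX : D.heart X) (w : List (Fin 2))
    (hw : w.length ≤ n) : (basic h w.length).heart.shift (degree w : ℤ) (S.vertex w) := by
  refine heart_of_torsion_tree h ?_ (fun w hw _ => ⟨S.torsion_mem w hw, S.torsionFree_mem w hw⟩)
    w hw
  rw [heart_shift_iff, basic_zero_isLE_iff h hn, basic_zero_isGE_iff h hn, ← D.mem_heart_iff]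
  exact D.heart.prop_of_iso S.root.symm hX

lemma heart_leaf (hn : OfType D T n 0) (hX : D.heart X) (w : List (Fin 2))
    (hw : w.length = n) : T.heart.shift (degree w : ℤ) (S.vertex w) := by
  have := S.heart_vertex hn hX w hw.le
  rwa [heart_shift_iff, hw, basic_gap_isLE_iff h hn, basic_gap_isGE_iff h hn,
    ← heart_shift_iff] at this

section

variable [IsTriangulated C]

lemma exists_triangle {w : List (Fin 2)} (hw : w.length < n) :
    ∃ δ, Triangle.mk (S.incl w) (S.proj w) δ ∈ distTriang C :=
  ((shortExactIn_heart_shift_iff _ _ _ _).1 (S.shortExact w hw)).2.2.2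

lemma isIso_incl {w : List (Fin 2)} (hw : w.length < n)
    (hV : (basic h (w.length + 1)).IsLE (S.vertex w) (degree w)) :
    IsIso (S.incl w) ∧ IsZero (S.vertex (w ++ [1])) := by
  obtain ⟨δ, hT⟩ := S.exists_triangle hw
  exact isIso_mor₁_of_isLE _ hT _ (S.isLE_append_zero hw) (S.isGE_append_one hw) hV

lemma isZero_append {w : List (Fin 2)} (hV : IsZero (S.vertex w)) (u : List (Fin 2))
    (hu : (w ++ u).length ≤ n) : IsZero (S.vertex (w ++ u)) := by
  induction u using List.reverseRecOn with
  | nil => simpa using hV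
  | append_singleton u a ih =>
    rw [← List.append_assoc] at hu ⊢
    rw [List.length_append, List.length_singleton] at hu
    have hz := ih (by lia)
    obtain ⟨δ, hT⟩ := S.exists_triangle (w := w ++ u) (by lia)
    match a with
    | 0 => exact (isIso_mor₂_of_isGE _ hT _ (S.isLE_append_zero (by lia))
        (S.isGE_append_one (by lia)) (TStructure.isGE_of_isZero _ hz _)).2
    | 1 => exact (S.isIso_incl (by lia) (TStructure.isLE_of_isZero _ hz _)).2

/-- If both children vanish, the triangle forces the parent to vanish; so a nonzero vertex always
has a nonzero child. -/
lemma exists_nonzero_leaf (m : ℕ) (w : List (Fin 2)) (hw : w.length + m = n)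
    (hV : ¬ IsZero (S.vertex w)) :
    ∃ u : List (Fin 2), (w ++ u).length = n ∧ ¬ IsZero (S.vertex (w ++ u)) := by
  induction m generalizing w with
  | zero => exact ⟨[], by simpa using hw, by simpa using hV⟩
  | succ m ih =>
    have step (a : Fin 2) (ha : ¬ IsZero (S.vertex (w ++ [a]))) :
        ∃ u : List (Fin 2), (w ++ u).length = n ∧ ¬ IsZero (S.vertex (w ++ u)) := by
      obtain ⟨u, hu, hu'⟩ := ih (w ++ [a])
        (by rw [List.length_append, List.length_singleton]; lia) ha
      exact ⟨[a] ++ u, by rwa [← List.append_assoc], by rwa [← List.append_assoc]⟩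
    by_cases h₀ : IsZero (S.vertex (w ++ [0]))
    · by_cases h₁ : IsZero (S.vertex (w ++ [1]))
      · obtain ⟨δ, hT⟩ := S.exists_triangle (w := w) (by lia)
        have : IsIso (S.incl w) := (Triangle.isZero₃_iff_isIso₁ _ hT).1 h₁
        exact (hV (h₀.of_iso (asIso (S.incl w)).symm)).elim
      · exact step 1 h₁
    · exact step 0 h₀

lemma isNonzeroBranch_iff (w : List (Fin 2)) :
    S.IsNonzeroBranch w ↔ w.length = n ∧ ¬ IsZero (S.vertex w) := by
  refine and_congr_right fun hw => ⟨fun H => ?_, fun H l hl hz => H ?_⟩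
  · have := H n le_rfl
    rwa [List.take_of_length_le hw.le] at this
  · have := S.isZero_append hz (w.drop l) (by rw [List.take_append_drop, hw])
    rwa [List.take_append_drop] at this

end

end RightTTree

end TTree

namespace TTree

variable {C : Type u} [Category.{v} C] [Preadditive C] [HasZeroObject C] [HasShift C ℤ]
  [∀ n : ℤ, (shiftFunctor C n).Additive] [Pretriangulated C]

/-! ### Combinatorics of words -/

section Words

lemma length_ones (i : ℕ) : (ones i).length = i := by simp [ones_eq]

lemma length_onesZeros (i j : ℕ) : (onesZeros i j).length = i + j := by simp [onesZeros_eq]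

lemma degree_ones (i : ℕ) : degree (ones i) = i := by simp [ones_eq, degree]

lemma degree_onesZeros (i j : ℕ) : degree (onesZeros i j) = i := by simp [onesZeros_eq, degree]

lemma onesZeros_succ (i j : ℕ) : onesZeros i (j + 1) = onesZeros i j ++ [0] := rfl

lemma ones_append_zero (i j : ℕ) :
    ones i ++ [0] ++ List.replicate j 0 = onesZeros i (j + 1) := by
  rw [onesZeros_eq, ones_eq, List.replicate_succ, List.append_assoc, List.singleton_append]

/-- A word which is not of the form `1 ⋯ 1` contains a first zero. -/
lemma eq_ones_or (w : List (Fin 2)) :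
    w = ones w.length ∨ ∃ i u, w = ones i ++ [0] ++ u := by
  induction w using List.reverseRecOn with
  | nil => exact .inl rfl
  | append_singleton w a ih =>
    rcases ih with ih | ⟨i, u, ih⟩
    · match a with
      | 0 => exact .inr ⟨w.length, [], by rw [← ih, List.append_nil]⟩
      | 1 => exact .inl (by
          rw [List.length_append, List.length_singleton, ones, ← ih])
    · exact .inr ⟨i, u ++ [a], by rw [ih, List.append_assoc (ones i ++ [0])]⟩

/-- In a word of the form `1 ⋯ 1 0 ⋯ 0`, no one occurs after a zero. -/
lemma onesZeros_succ_append_one_ne (i j d k : ℕ) (u : List (Fin 2)) :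
    onesZeros i (j + 1) ++ [1] ++ u ≠ onesZeros d k := by
  intro e
  have hp : (onesZeros d k).Pairwise (· ≥ ·) := by
    simp [onesZeros_eq, List.pairwise_append, List.pairwise_replicate]
  rw [← e, List.append_assoc, List.pairwise_append] at hp
  have := hp.2.2 0 (by simp [onesZeros_succ]) 1 (by simp)
  exact absurd this (by decide)

end Words

/-- An object of `H_D` lies in `T^{≥ 0} ∩ T^{≤ n}`. -/
lemma OfType.static_degree_bounds {D T : TStructure C} {n : ℕ} {X : C}
    (hn : OfType D T n 0) (hX : D.heart X) (hX0 : ¬ IsZero X) {d : ℤ}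
    (hd : T.heart.shift d X) : 0 ≤ d ∧ d ≤ n := by
  obtain ⟨h₁, h₂⟩ := (heart_shift_iff T d X).1 hd
  obtain ⟨h₃, h₄⟩ := (D.mem_heart_iff X).1 hX
  have h₅ := hn.isGE_of_isGE h₄
  have h₆ := hn.isLE_add_of_isLE h₃
  constructor
  · by_contra hlt
    exact hX0 (T.isZero X d 0)
  · by_contra hlt
    exact hX0 (T.isZero X (0 + n) d)

namespace RightTTree

variable {D T : TStructure C} {h : RightFilterable D T} {n : ℕ} {X : C}
  (S : RightTTree h n X)

lemma heart_leading_leaf (hS : S.NonzeroLeavesAreLeadingInHeart) (i : ℕ)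
    (hi : i ≤ n) : D.heart (S.vertex (onesZeros i (n - i))) := by
  by_cases hz : IsZero (S.vertex (onesZeros i (n - i)))
  · exact (D.mem_heart_iff _).2 ⟨D.isLE_of_isZero hz 0, D.isGE_of_isZero hz 0⟩
  · exact (hS _ (by rw [length_onesZeros]; lia) hz).2

lemma leading_leaf_isLE_isGE (hn : OfType D T n 0) (hX : D.heart X) (i : ℕ)
    (hi : i ≤ n) :
    T.IsLE (S.vertex (onesZeros i (n - i))) i ∧ T.IsGE (S.vertex (onesZeros i (n - i))) i := by
  have := S.heart_leaf hn hX (onesZeros i (n - i)) (by rw [length_onesZeros]; lia)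
  rwa [degree_onesZeros, heart_shift_iff] at this

lemma exists_truncGE_zero_iso (hX : T.IsGE X 0) :
    ∃ e : (T.truncGE ((0 : ℕ) : ℤ)).obj X ≅ S.vertex (ones 0),
      (T.truncGEπ ((0 : ℕ) : ℤ)).app X ≫ e.hom = S.root.inv ≫ S.toOnes 0 := by
  have : T.IsGE X ((0 : ℕ) : ℤ) := hX
  exact ⟨(asIso ((T.truncGEπ ((0 : ℕ) : ℤ)).app X)).symm ≪≫ S.root.symm,
    ((asIso ((T.truncGEπ ((0 : ℕ) : ℤ)).app X)).hom_inv_id_assoc _).trans (Category.comp_id _).symm⟩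

end RightTTree

variable [IsTriangulated C]

/-! ### Matching the rightmost branch with `T`-truncations -/

section Truncation

variable (T : TStructure C)

/-- The auxiliary `t` is any t-structure for which the tree's triangle and the `T`-truncation
triangle are both truncations at `i`. It is `D_{i+1}` when the cohomology is known to lie in `H_D`,
and `T` when the leaves are known to be leading. -/
lemma exists_truncGE_iso_step {t : TStructure C} {X L V W : C} {i : ℤ} {f : L ⟶ V} {g : V ⟶ W}
    {δ : W ⟶ L⟦(1 : ℤ)⟧} (hT : Triangle.mk f g δ ∈ distTriang C) {p : X ⟶ V}
    (e : (T.truncGE i).obj X ≅ V) (he : (T.truncGEπ i).app X ≫ e.hom = p)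
    (hL : t.IsLE L i) (hW : t.IsGE W (i + 1))
    (h₁ : t.IsLE ((T.truncLE i).obj ((T.truncGE i).obj X)) i)
    (h₂ : t.IsGE ((T.truncGE (i + 1)).obj X) (i + 1)) :
    Nonempty (L ≅ (T.truncLE i).obj ((T.truncGE i).obj X)) ∧
      ∃ e' : (T.truncGE (i + 1)).obj X ≅ W, (T.truncGEπ (i + 1)).app X ≫ e'.hom = p ≫ g := by
  obtain ⟨f', g', δ', hT', hg⟩ := exists_truncGE_triangle T X i
  obtain ⟨a, c, -, hc⟩ := exists_iso_of_truncation_triangles t hT' hT e i h₁ h₂ hL hW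
  exact ⟨⟨a.symm⟩, c, by rw [← hg, Category.assoc, hc, ← Category.assoc, he]⟩

lemma nonempty_truncLE_truncGE_iso_truncGE {X : C} {i : ℤ} (hX : T.IsLE X i) :
    Nonempty ((T.truncLE i).obj ((T.truncGE i).obj X) ≅ (T.truncGE i).obj X) := by
  have : T.IsLE ((T.truncGE i).obj X) i := inferInstance
  exact ⟨asIso ((T.truncLEι i).app _)⟩

/-- If all the cohomology objects `H^i_T(X)[-i]` lie in the heart of `D`, then so do the
truncations of `X`. -/
lemma heart_truncGE {D : TStructure C} {n : ℕ} {X : C} (hX : T.IsLE X n)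
    (H : ∀ i : ℕ, i ≤ n → D.heart ((T.truncLE i).obj ((T.truncGE i).obj X))) (i : ℕ)
    (hi : i ≤ n + 1) : D.heart ((T.truncGE i).obj X) := by
  -- The descent starts at `n + 1`, where the truncation vanishes, and proceeds by closure of `H_D`
  -- under extensions.
  induction hi using Nat.decreasingInduction with
  | self =>
    have hz := T.isZero_truncGE_obj_of_isLE n (n + 1 : ℕ) (by simp) X
    exact (D.mem_heart_iff _).2 ⟨D.isLE_of_isZero hz 0, D.isGE_of_isZero hz 0⟩
  | of_succ i hi ih =>
    obtain ⟨f, g, δ, hT, -⟩ := exists_truncGE_triangle T X i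
    rw [Nat.cast_add, Nat.cast_one, D.mem_heart_iff] at ih
    obtain ⟨h₁, h₂⟩ := (D.mem_heart_iff _).1 (H i (by lia))
    exact (D.mem_heart_iff _).2 ⟨D.isLE₂ _ hT 0 h₁ ih.1, D.isGE₂ _ hT 0 h₂ ih.2⟩

end Truncation

namespace RightTTree

variable {D T : TStructure C} {h : RightFilterable D T} {n : ℕ} {X : C}
  (S : RightTTree h n X)

/-- Since `T^{≤ i} ⊆ D_k^{≤ i}` for every `k`, all further truncations of an object in `T^{≤ i}` at
`i` are trivial. -/
lemma incl_onesZeros {i j : ℕ} (hij : i + j < n)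
    (e : Nonempty (S.vertex (onesZeros i j) ≅ (T.truncLE i).obj ((T.truncGE i).obj X))) :
    IsIso (S.incl (onesZeros i j)) ∧ IsZero (S.vertex (onesZeros i j ++ [1])) := by
  obtain ⟨e⟩ := e
  refine S.isIso_incl (by rwa [length_onesZeros]) ?_
  rw [degree_onesZeros]
  have := basic_isLE_of_isLE h ((onesZeros i j).length + 1)
    (inferInstance : T.IsLE ((T.truncLE i).obj ((T.truncGE i).obj X)) i)
  exact TStructure.isLE_of_iso _ e.symm _

/-! ### Trees of objects with `D`-static cohomology -/

section Static

variable (hn : OfType D T n 0) (hX : D.heart X)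
  (H : ∀ i : ℕ, i ≤ n → D.heart ((T.truncLE i).obj ((T.truncGE i).obj X)))

include hn hX H

lemma ones_step {i : ℕ} (hi : i < n)
    (hV : ∃ e : (T.truncGE i).obj X ≅ S.vertex (ones i),
      (T.truncGEπ i).app X ≫ e.hom = S.root.inv ≫ S.toOnes i) :
    Nonempty (S.vertex (ones i ++ [0]) ≅ (T.truncLE i).obj ((T.truncGE i).obj X)) ∧
      ∃ e : (T.truncGE (i + 1 : ℕ)).obj X ≅ S.vertex (ones (i + 1)),
        (T.truncGEπ (i + 1 : ℕ)).app X ≫ e.hom = S.root.inv ≫ S.toOnes (i + 1) := by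
  obtain ⟨e, he⟩ := hV
  have hw : (ones i).length < n := by rwa [length_ones]
  obtain ⟨δ, hT⟩ := S.exists_triangle hw
  have h₁ := S.isLE_append_zero hw
  have h₂ := S.isGE_append_one hw
  rw [length_ones, degree_ones] at h₁ h₂
  have hXT : T.IsLE X n := by
    simpa using hn.isLE_add_of_isLE ((D.mem_heart_iff X).1 hX).1
  have hG := heart_truncGE T hXT H (i + 1) (by lia)
  rw [Nat.cast_add, Nat.cast_one] at hG ⊢
  -- `D_{i+1}^{≥ i+1}` is `D^{≥ 0} ∩ T^{≥ i+1}`, so membership of `τ^{≥ i+1} X` in `H_D` is what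
  -- makes the `T`-triangle a `D_{i+1}`-truncation.
  obtain ⟨h₃, c, hc⟩ := exists_truncGE_iso_step T hT e he h₁ h₂
    (basic_isLE_of_isLE h _ inferInstance)
    ((basic_isGE_iff h _ _ _).2 ⟨by simpa using ((D.mem_heart_iff _).1 hG).2, inferInstance⟩)
  exact ⟨h₃, c, hc.trans (Category.assoc _ _ _)⟩

lemma exists_truncGE_iso (i : ℕ) (hi : i ≤ n) :
    ∃ e : (T.truncGE i).obj X ≅ S.vertex (ones i),
      (T.truncGEπ i).app X ≫ e.hom = S.root.inv ≫ S.toOnes i := by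
  induction i with
  | zero => exact S.exists_truncGE_zero_iso (hn.isGE_of_isGE ((D.mem_heart_iff X).1 hX).2)
  | succ i ih => exact (S.ones_step hn hX H hi (ih (by lia))).2

lemma nonempty_onesZeros_succ_iso (i j : ℕ) (hij : i + (j + 1) ≤ n) :
    Nonempty (S.vertex (onesZeros i (j + 1)) ≅ (T.truncLE i).obj ((T.truncGE i).obj X)) := by
  induction j with
  | zero => exact (S.ones_step hn hX H (by lia) (S.exists_truncGE_iso hn hX H i (by lia))).1
  | succ j ih =>
    obtain ⟨e⟩ := ih (by lia)
    have : IsIso (S.incl (onesZeros i (j + 1))) :=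
      (S.incl_onesZeros (by lia) ⟨e⟩).1
    exact ⟨@asIso _ _ _ _ (S.incl (onesZeros i (j + 1))) this ≪≫ e⟩

lemma nonempty_leading_leaf_iso (i : ℕ) (hi : i ≤ n) :
    Nonempty (S.vertex (onesZeros i (n - i)) ≅ (T.truncLE i).obj ((T.truncGE i).obj X)) := by
  rcases hi.lt_or_eq with hlt | rfl
  · obtain ⟨j, hj⟩ : ∃ j, n - i = j + 1 := ⟨n - i - 1, by lia⟩
    rw [hj]
    exact S.nonempty_onesZeros_succ_iso hn hX H i j (by lia)
  -- For `i = n` there is no child left; since `X` lies in `T^{≤ n}`, `τ^{≥ n} X` is already `τ^{≤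
  -- n} τ^{≥ n} X`.
  · rw [Nat.sub_self]
    obtain ⟨e, -⟩ := S.exists_truncGE_iso hn hX H i le_rfl
    have hXT : T.IsLE X i := by
      simpa using hn.isLE_add_of_isLE ((D.mem_heart_iff X).1 hX).1
    obtain ⟨c⟩ := nonempty_truncLE_truncGE_iso_truncGE T hXT
    exact ⟨e.symm ≪≫ c.symm⟩

/-- At the first one following a zero the vertex vanishes by `incl_onesZeros`, and everything below
it vanishes too. -/
lemma isZero_of_ne_replicate (i : ℕ) (u : List (Fin 2)) (hu : i + 1 + u.length ≤ n)
    (hne : u ≠ List.replicate u.length 0) : IsZero (S.vertex (ones i ++ [0] ++ u)) := by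
  induction u using List.reverseRecOn with
  | nil => exact (hne rfl).elim
  | append_singleton u a ih =>
    rw [List.length_append, List.length_singleton] at hu hne
    rw [← List.append_assoc]
    by_cases hu' : u = List.replicate u.length 0
    · match a with
      | 0 => exact (hne (by rw [List.replicate_succ', ← hu'])).elim
      | 1 =>
        rw [hu', ones_append_zero]
        exact (S.incl_onesZeros (by lia)
          (S.nonempty_onesZeros_succ_iso hn hX H i _ (by lia))).2
    · refine S.isZero_append (ih (by lia) hu') [a] ?_
      simp only [List.length_append, List.length_singleton, length_ones]
      lia

lemma vertex_cases (w : List (Fin 2)) (hw : w.length ≤ n) :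
    w = ones w.length ∨ (∃ i j, i + (j + 1) = w.length ∧ w = onesZeros i (j + 1)) ∨
      IsZero (S.vertex w) := by
  rcases eq_ones_or w with hw' | ⟨i, u, rfl⟩
  · exact .inl hw'
  · simp only [List.length_append, List.length_singleton, length_ones] at hw
    by_cases hu : u = List.replicate u.length 0
    · refine .inr (.inl ⟨i, u.length, ?_, ?_⟩)
      · simp only [List.length_append, List.length_singleton, length_ones]
        lia
      · rw [← ones_append_zero, ← hu]
    · exact .inr (.inr (S.isZero_of_ne_replicate hn hX H i u hw hu))

lemma heart_vertex_of_static (w : List (Fin 2)) (hw : w.length ≤ n) : D.heart (S.vertex w) := by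
  have hXT : T.IsLE X n := by
    simpa using hn.isLE_add_of_isLE ((D.mem_heart_iff X).1 hX).1
  rcases S.vertex_cases hn hX H w hw with hw' | ⟨i, j, hij, rfl⟩ | hz
  · rw [hw']
    obtain ⟨e, -⟩ := S.exists_truncGE_iso hn hX H w.length hw
    exact D.heart.prop_of_iso e (heart_truncGE T hXT H _ (by lia))
  · obtain ⟨e⟩ := S.nonempty_onesZeros_succ_iso hn hX H i j (by lia)
    exact D.heart.prop_of_iso e.symm (H i (by lia))
  · exact (D.mem_heart_iff _).2 ⟨D.isLE_of_isZero hz 0, D.isGE_of_isZero hz 0⟩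

lemma leaf_eq_onesZeros (w : List (Fin 2)) (hw : w.length = n) (hV : ¬ IsZero (S.vertex w)) :
    ∃ d : ℕ, d ≤ n ∧ w = onesZeros d (n - d) := by
  rcases S.vertex_cases hn hX H w hw.le with hw' | ⟨i, j, hij, rfl⟩ | hz
  · exact ⟨n, le_rfl, by rw [hw', hw, Nat.sub_self]; rfl⟩
  · exact ⟨i, by lia, by congr 1; lia⟩
  · exact (hV hz).elim

end Static

/-! ### Recovering the cohomology from leading leaves -/

section Leading

variable (hn : OfType D T n 0) (hX : D.heart X) (hS : S.NonzeroLeavesAreLeadingInHeart)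

include hS in
lemma incl_of_leading {i j : ℕ} (hij : i + (j + 1) < n) :
    IsIso (S.incl (onesZeros i (j + 1))) := by
  -- A nonzero vertex here would have a nonzero leaf below it, whose word has a one after a zero.
  have hz : IsZero (S.vertex (onesZeros i (j + 1) ++ [1])) := by
    by_contra hz
    obtain ⟨u, hu, hu'⟩ := S.exists_nonzero_leaf (n - (i + (j + 1) + 1)) _
      (by rw [List.length_append, List.length_singleton, length_onesZeros]; lia) hz
    obtain ⟨⟨d, hd, e⟩, -⟩ := hS _ hu hu'
    exact onesZeros_succ_append_one_ne _ _ _ _ _ e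
  obtain ⟨δ, hT⟩ := S.exists_triangle (w := onesZeros i (j + 1)) (by rwa [length_onesZeros])
  exact (Triangle.isZero₃_iff_isIso₁ _ hT).1 hz

include hS in
lemma nonempty_leaf_iso_of_leading {i : ℕ} (j : ℕ) (hij : i + (j + 1) ≤ n) :
    Nonempty (S.vertex (onesZeros i (j + 1)) ≅ S.vertex (onesZeros i (n - i))) := by
  obtain ⟨k, hk⟩ : ∃ k, n - i = j + 1 + k := ⟨n - i - (j + 1), by lia⟩
  rw [hk]
  replace hk : i + (j + 1 + k) ≤ n := by lia
  clear hij
  induction k with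
  | zero => exact ⟨Iso.refl _⟩
  | succ k ih =>
    obtain ⟨e⟩ := ih (by lia)
    have := S.incl_of_leading hS (i := i) (j := j + k) (by lia)
    rw [show j + k + 1 = j + 1 + k by lia] at this
    exact ⟨e ≪≫ (asIso (S.incl (onesZeros i (j + 1 + k)))).symm⟩

include hn hX hS

/-- Descending induction from the last leaf: each `X_{1..1}` is an extension of the next one by a
leading leaf, and `T^{≥ i}` is closed under extensions. -/
lemma isGE_ones_of_leading (i : ℕ) (hi : i ≤ n) : T.IsGE (S.vertex (ones i)) i := by
  induction hi using Nat.decreasingInduction with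
  | self =>
    have := (S.leading_leaf_isLE_isGE hn hX n le_rfl).2
    rwa [Nat.sub_self] at this
  | of_succ i hi ih =>
    obtain ⟨δ, hT⟩ := S.exists_triangle (w := ones i) (by rwa [length_ones])
    obtain ⟨e⟩ := S.nonempty_leaf_iso_of_leading hS (i := i) 0 (by lia)
    have := (S.leading_leaf_isLE_isGE hn hX i hi.le).2
    exact T.isGE₂ _ hT i (T.isGE_of_iso e.symm i)
      (T.isGE_of_ge (S.vertex (ones (i + 1))) i (i + 1 : ℕ))

lemma ones_step_of_leading {i : ℕ} (hi : i < n)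
    (hV : ∃ e : (T.truncGE i).obj X ≅ S.vertex (ones i),
      (T.truncGEπ i).app X ≫ e.hom = S.root.inv ≫ S.toOnes i) :
    Nonempty (S.vertex (ones i ++ [0]) ≅ (T.truncLE i).obj ((T.truncGE i).obj X)) ∧
      ∃ e : (T.truncGE (i + 1 : ℕ)).obj X ≅ S.vertex (ones (i + 1)),
        (T.truncGEπ (i + 1 : ℕ)).app X ≫ e.hom = S.root.inv ≫ S.toOnes (i + 1) := by
  obtain ⟨e, he⟩ := hV
  obtain ⟨δ, hT⟩ := S.exists_triangle (w := ones i) (by rwa [length_ones])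
  obtain ⟨c⟩ := S.nonempty_leaf_iso_of_leading hS (i := i) 0 (by lia)
  have h₁ := (S.leading_leaf_isLE_isGE hn hX i hi.le).1
  have h₂ := S.isGE_ones_of_leading hn hX hS (i + 1) hi
  rw [Nat.cast_add, Nat.cast_one] at h₂ ⊢
  obtain ⟨h₃, d, hd⟩ := exists_truncGE_iso_step T hT e he (T.isLE_of_iso c.symm i) h₂
    inferInstance inferInstance
  exact ⟨h₃, d, hd.trans (Category.assoc _ _ _)⟩

lemma exists_truncGE_iso_of_leading (i : ℕ) (hi : i ≤ n) :
    ∃ e : (T.truncGE i).obj X ≅ S.vertex (ones i),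
      (T.truncGEπ i).app X ≫ e.hom = S.root.inv ≫ S.toOnes i := by
  induction i with
  | zero => exact S.exists_truncGE_zero_iso (hn.isGE_of_isGE ((D.mem_heart_iff X).1 hX).2)
  | succ i ih => exact (S.ones_step_of_leading hn hX hS hi (ih (by lia))).2

lemma heart_truncLE_truncGE_of_leading (i : ℕ) (hi : i ≤ n) :
    D.heart ((T.truncLE i).obj ((T.truncGE i).obj X)) := by
  have hL := S.heart_leading_leaf hS i hi
  obtain ⟨e, he⟩ := S.exists_truncGE_iso_of_leading hn hX hS i hi
  rcases hi.lt_or_eq with hlt | rfl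
  · obtain ⟨a⟩ := (S.ones_step_of_leading hn hX hS hlt ⟨e, he⟩).1
    obtain ⟨b⟩ := S.nonempty_leaf_iso_of_leading hS (i := i) 0 (by lia)
    exact D.heart.prop_of_iso (b.symm ≪≫ a) hL
  · rw [Nat.sub_self] at hL
    have hXT : T.IsLE X i := by
      simpa using hn.isLE_add_of_isLE ((D.mem_heart_iff X).1 hX).1
    obtain ⟨c⟩ := nonempty_truncLE_truncGE_iso_truncGE T hXT
    exact D.heart.prop_of_iso (e.symm ≪≫ c.symm) hL

end Leading

/-! ### Unique nonzero branches and `T`-static objects -/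

section UniqueBranch

/-- If `X_w` is the only nonzero leaf, then all the vertices on its branch are isomorphic
to `X`. -/
lemma nonempty_root_iso_of_unique {w : List (Fin 2)} (hw : w.length = n)
    (hu : ∀ w' : List (Fin 2), w'.length = n → ¬ IsZero (S.vertex w') → w' = w) (v u : List (Fin 2))
    (hv : v ++ u = w) : Nonempty (S.vertex v ≅ X) := by
  induction v using List.reverseRecOn generalizing u with
  | nil => exact ⟨S.root⟩
  | append_singleton v a ih =>
    obtain ⟨e⟩ := ih ([a] ++ u) (by rw [← List.append_assoc, hv])
    have hl := congr_arg List.length hv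
    simp only [List.length_append, List.length_singleton] at hl
    -- A nonzero sibling would lead to a second nonzero leaf.
    have sibling (b : Fin 2) (hb : b ≠ a) : IsZero (S.vertex (v ++ [b])) := by
      by_contra hz
      obtain ⟨u', h₁, h₂⟩ := S.exists_nonzero_leaf (n - (v.length + 1)) (v ++ [b])
        (by rw [List.length_append, List.length_singleton]; lia) hz
      have := (hu _ h₁ h₂).trans hv.symm
      rw [List.append_assoc, List.append_assoc, List.append_cancel_left_eq] at this
      exact hb (List.cons.inj this).1
    obtain ⟨δ, hT⟩ := S.exists_triangle (w := v) (by lia)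
    match a with
    | 0 =>
      have : IsIso (S.incl v) := (Triangle.isZero₃_iff_isIso₁ _ hT).1 (sibling 1 (by decide))
      exact ⟨asIso (S.incl v) ≪≫ e⟩
    | 1 =>
      have : IsIso (S.proj v) := (Triangle.isZero₁_iff_isIso₂ _ hT).1 (sibling 0 (by decide))
      exact ⟨(asIso (S.proj v)).symm ≪≫ e⟩

lemma static_of_hasUniqueNonzeroBranch (hn : OfType D T n 0) (hX : D.heart X)
    (hS : S.HasUniqueNonzeroBranch) : Static T X := by
  obtain ⟨w, hw, hu⟩ := hS
  simp only [isNonzeroBranch_iff] at hw hu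
  obtain ⟨e⟩ := S.nonempty_root_iso_of_unique hw.1 (fun w' h₁ h₂ => hu w' ⟨h₁, h₂⟩) w [] (by simp)
  exact ⟨degree w, (T.heart.shift (degree w : ℤ)).prop_of_iso e (S.heart_leaf hn hX w hw.1)⟩

lemma leaf_iff_of_static (hn : OfType D T n 0) (hX : D.heart X) (hX0 : ¬ IsZero X) {m : ℕ}
    (hm : m ≤ n) (hd : T.heart.shift (m : ℤ) X) (w : List (Fin 2)) (hw : w.length = n) :
    ¬ IsZero (S.vertex w) ↔ w = onesZeros m (n - m) := by
  -- The double truncation is `X` itself for `i = m` and zero otherwise, so the analysis of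
  -- `D`-static cohomology applies.
  have H (i : ℕ) (_ : i ≤ n) : D.heart ((T.truncLE i).obj ((T.truncGE i).obj X)) := by
    by_cases him : i = m
    · subst him
      obtain ⟨e⟩ := nonempty_truncLE_truncGE_iso T hd
      exact D.heart.prop_of_iso e.symm hX
    · have hz := isZero_truncLE_truncGE T hd (i := i) (by exact_mod_cast him)
      exact (D.mem_heart_iff _).2 ⟨D.isLE_of_isZero hz 0, D.isGE_of_isZero hz 0⟩
  constructor
  · intro hV
    obtain ⟨d, hdn, rfl⟩ := S.leaf_eq_onesZeros hn hX H w hw hV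
    obtain ⟨e⟩ := S.nonempty_leading_leaf_iso hn hX H d hdn
    obtain rfl : d = m := by
      by_contra hdm
      exact hV ((isZero_truncLE_truncGE T hd (i := d) (by exact_mod_cast hdm)).of_iso e)
    rfl
  · rintro rfl hz
    obtain ⟨e⟩ := S.nonempty_leading_leaf_iso hn hX H m hm
    obtain ⟨e'⟩ := nonempty_truncLE_truncGE_iso T hd
    exact hX0 (hz.of_iso (e ≪≫ e').symm)

lemma hasUniqueNonzeroBranch_of_static (hn : OfType D T n 0) (hX : D.heart X)
    (hX0 : ¬ IsZero X) {m : ℕ} (hm : m ≤ n) (hd : T.heart.shift (m : ℤ) X) :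
    S.HasUniqueNonzeroBranch := by
  have hl : (onesZeros m (n - m)).length = n := by rw [length_onesZeros]; lia
  refine ⟨onesZeros m (n - m), (S.isNonzeroBranch_iff _).2
    ⟨hl, (S.leaf_iff_of_static hn hX hX0 hm hd _ hl).2 rfl⟩, fun w hw => ?_⟩
  obtain ⟨h₁, h₂⟩ := (S.isNonzeroBranch_iff w).1 hw
  exact (S.leaf_iff_of_static hn hX hX0 hm hd w h₁).1 h₂

end UniqueBranch

end RightTTree

end TTree

/-! ### Assembly -/

theorem mainTheorem10 {C : Type u} [Category.{v} C] [Preadditive C] [HasZeroObject C]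
    [HasShift C ℤ] [∀ m : ℤ, (shiftFunctor C m).Additive] [Pretriangulated C] [IsTriangulated C]
    (D T : TStructure C) (hD : TTree.NonDegenerate D) (hT : TTree.NonDegenerate T)
    (h : TTree.RightFilterable D T) (n : ℕ) (hn : TTree.OfType D T n 0)
    (X : C) (hX : D.heart X) (hX0 : ¬ IsZero X) :
    -- trees all of whose nonzero leaves are leading leaves in the heart of `D`
    ((∃ S : TTree.RightTTree h n X, S.NonzeroLeavesAreLeadingInHeart) ↔
      ∀ i : ℕ, i ≤ n → TTree.StaticOfDegree D (-(i : ℤ)) ((TTree.cohomology T i).obj X)) ∧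
    ((∀ i : ℕ, i ≤ n → TTree.StaticOfDegree D (-(i : ℤ)) ((TTree.cohomology T i).obj X)) →
      ∀ S : TTree.RightTTree h n X,
        S.NonzeroLeavesAreLeadingInHeart ∧
        -- all vertices lie in the heart of `D`
        (∀ w : List (Fin 2), w.length ≤ n → D.heart (S.vertex w)) ∧
        -- `X_{1...1}` is the truncation of `X`, as an object under `X`
        (∀ i : ℕ, i ≤ n → ∃ e : (T.truncGE i).obj X ≅ S.vertex (TTree.ones i),
          (T.truncGEπ i).app X ≫ e.hom = S.root.inv ≫ S.toOnes i) ∧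
        -- the leading leaves
        (∀ i : ℕ, i ≤ n → Nonempty (S.vertex (TTree.onesZeros i (n - i)) ≅
          ((TTree.cohomology T i).obj X)⟦(-(i : ℤ))⟧)) ∧
        -- the vertices between `X_{1...10}` and the leading leaf
        (∀ i j : ℕ, 1 ≤ j → i + j ≤ n → Nonempty (S.vertex (TTree.onesZeros i j) ≅
          ((TTree.cohomology T i).obj X)⟦(-(i : ℤ))⟧)) ∧
        (∀ i j : ℕ, 1 ≤ j → i + j < n → IsIso (S.incl (TTree.onesZeros i j))) ∧
        -- the vanishing vertices
        (∀ (i : ℕ) (u : List (Fin 2)), i + 1 + u.length ≤ n →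
          u ≠ List.replicate u.length 0 → IsZero (S.vertex (TTree.ones i ++ [0] ++ u)))) ∧
    -- trees with a unique nonzero branch
    ((∃ S : TTree.RightTTree h n X, S.HasUniqueNonzeroBranch) ↔ TTree.Static T X) ∧
    (∀ d : ℤ, TTree.StaticOfDegree T d X →
      ∃ m : ℕ, (m : ℤ) = d ∧ m ≤ n ∧ ∀ S : TTree.RightTTree h n X,
        S.HasUniqueNonzeroBranch ∧
        ∀ w : List (Fin 2), w.length = n →
          (¬ IsZero (S.vertex w) ↔ w = TTree.onesZeros m (n - m))) := by
  -- `StaticOfDegree D (-i)` tests the shift by `-i`, which turns `H^i_T(X)` into the double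
  -- truncation.
  have hcoh (i : ℕ) : TTree.StaticOfDegree D (-(i : ℤ)) ((TTree.cohomology T i).obj X) ↔
      D.heart ((T.truncLE i).obj ((T.truncGE i).obj X)) :=
    D.heart.prop_iff_of_iso (TTree.nonempty_cohomology_shift_iso T X i).some
  have c (i : ℕ) := (TTree.nonempty_cohomology_shift_iso T X i).some.symm
  have hX' : (TTree.basic h 0).heart.shift (0 : ℤ) X := by
    rwa [TTree.heart_shift_iff, TTree.basic_zero_isLE_iff h hn, TTree.basic_zero_isGE_iff h hn,
      ← D.mem_heart_iff]
  simp only [hcoh]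
  have leading (H : ∀ i : ℕ, i ≤ n → D.heart ((T.truncLE i).obj ((T.truncGE i).obj X)))
      (S : TTree.RightTTree h n X) : S.NonzeroLeavesAreLeadingInHeart := fun w hw hV =>
    ⟨S.leaf_eq_onesZeros hn hX H w hw hV, S.heart_vertex_of_static hn hX H w hw.le⟩
  refine ⟨⟨fun ⟨S, hS⟩ => S.heart_truncLE_truncGE_of_leading hn hX hS,
    fun H => ⟨TTree.truncTree h hX' n, leading H _⟩⟩, fun H S => ⟨leading H S,
      S.heart_vertex_of_static hn hX H, S.exists_truncGE_iso hn hX H, fun i hi => ?_,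
      fun i j hj hij => ?_, fun i j hj hij => ?_, S.isZero_of_ne_replicate hn hX H⟩,
    ⟨fun ⟨S, hS⟩ => S.static_of_hasUniqueNonzeroBranch hn hX hS, fun ⟨d, hd⟩ => ?_⟩,
    fun d hd => ?_⟩
  · exact ⟨(S.nonempty_leading_leaf_iso hn hX H i hi).some ≪≫ c i⟩
  · obtain ⟨j, rfl⟩ := Nat.exists_eq_add_of_le' hj
    exact ⟨(S.nonempty_onesZeros_succ_iso hn hX H i j hij).some ≪≫ c i⟩
  · obtain ⟨j, rfl⟩ := Nat.exists_eq_add_of_le' hj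
    exact (S.incl_onesZeros hij
      (S.nonempty_onesZeros_succ_iso hn hX H i j hij.le)).1
  · obtain ⟨h₀, h₁⟩ := hn.static_degree_bounds hX hX0 hd
    lift d to ℕ using h₀
    exact ⟨TTree.truncTree h hX' n, TTree.RightTTree.hasUniqueNonzeroBranch_of_static _ hn hX hX0
      (by exact_mod_cast h₁) hd⟩
  · obtain ⟨h₀, h₁⟩ := hn.static_degree_bounds hX hX0 hd
    lift d to ℕ using h₀
    have hm : d ≤ n := by exact_mod_cast h₁
    exact ⟨d, rfl, hm, fun S => ⟨S.hasUniqueNonzeroBranch_of_static hn hX hX0 hm hd,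
      S.leaf_iff_of_static hn hX hX0 hm hd⟩⟩
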